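/- Let $q>0$, let $a:[0,\infty)\to[0,\infty)$ be right-continuous (for instance continuous) and let $r:[0,\infty)\to[0,q]$. Below $'$ denotes the right-hand derivative, $[\cdot]$ is the greatest integer function and $[t]_h:=[t/h]\,h$. A solution of $$x'(t)=-a(t)\,x(t-r(t)) \qquad (1)$$ from time $s\ge 0$ is a continuous function on $[s-q,\infty)$ that satisfies (1) for all $t\ge s$; its initial value is its restriction to $[s-q,s]$. Assume: (A1) the zero solution of (1) is uniformly asymptotically stable, i.e. for every $\varepsilon>0$ there is $\delta>0$ such that for every $s\ge0$ each solution $x$ from time $s$ with $\sup_{[s-q,s]}|x|<\delta$ satisfies $|x(t)|<\varepsilon$ for $t\ge s$; and there is $b>0$ such that for every $\varepsilon>0$ there is $T>0$ such that for every $s\ge0$ each solution $x$ from time $s$ with $\sup_{[s-q,s]}|x|<b$ satisfies $|x(t)|<\varepsilon$ for $t\ge s+T$; (A2) $\sup_{t\ge0}a(t)<\infty$; (A3) $r$ is uniformly continuous on $[0,\infty)$. Then: 1. Let $\varphi\in C([-q,0],\mathbb R)$, let $x$ be the solution of (1) from time $0$ with $x=\varphi$ on $[-q,0]$ and, for $h\in(0,q]$,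 let $z_h$ be the solution of $$z_h'(t)=-a(t)\,z_h\big(\big[t-[r([t]_h)]_h\big]_h\big),\quad t\ge0,\qquad z_h(nh)=\varphi(nh)\ \text{ for integers } n \text{ with } -q\le nh\le 0,$$ continuous on $[0,\infty)$. Then $|x(t)-z_h([t]_h)|\to0$ as $h\to0^+$, for each $t\ge0$. 2. There is $h_0>0$ such that for every $h\in(0,h_0)$ the zero solution of the difference equation $$z(n+1)=z(n)-\Big(\int_{nh}^{(n+1)h}a(s)\,ds\Big)\,z(n-k_n),\qquad k_n=[r(nh)/h],$$ is uniformly asymptotically stable, i.e. for every $\varepsilon>0$ there is $\delta>0$ such that for every integer $m\ge0$ each solution $z$ for $n\ge m$ with $|z(j)|<\delta$ for all integers $j$ with $m-[q/h]\le j\le m$ satisfies $|z(n)|<\varepsilon$ for $n\ge m$; and there is $b>0$ such that for every $\varepsilon>0$ there is $N\in\mathbb N$ such that for every integer $m\ge0$ each solution $z$ for $n\ge m$ with $|z(j)|<b$ for all integers $j$ with $m-[q/h]\le j\le m$ satisfies $|z(n)|<\varepsilon$ for $n\ge m+N$. -/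

import Mathlib

/-- `x` solves `x'(t) = -a(t) x(t - r(t))` for `t ≥ s`, where `'` is the right-hand derivative:
`x` is continuous on `[s - q, ∞)` and satisfies the equation at every `t ≥ s`.
The initial value of `x` at `s` is its restriction to `[s - q, s]`. -/
structure IsDelaySolution (q : ℝ) (a r : ℝ → ℝ) (s : ℝ) (x : ℝ → ℝ) : Prop where
  continuousOn : ContinuousOn x (Set.Ici (s - q))
  hasDeriv : ∀ t, s ≤ t → HasDerivWithinAt x (-(a t * x (t - r t))) (Set.Ici t) t

/-- The zero solution of `x'(t) = -a(t) x(t - r(t))`, `t ≥ 0`, is uniformly asymptotically stable: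
it is uniformly stable and uniformly attractive, with constants independent of the
initial time `s ≥ 0`. -/
def DelayUAS (q : ℝ) (a r : ℝ → ℝ) : Prop :=
  (∀ ε > 0, ∃ δ > 0, ∀ s, 0 ≤ s → ∀ x, IsDelaySolution q a r s x →
    (∀ t ∈ Set.Icc (s - q) s, |x t| < δ) → ∀ t, s ≤ t → |x t| < ε) ∧
  (∃ b > 0, ∀ ε > 0, ∃ T > 0, ∀ s, 0 ≤ s → ∀ x, IsDelaySolution q a r s x →
    (∀ t ∈ Set.Icc (s - q) s, |x t| < b) → ∀ t, s + T ≤ t → |x t| < ε)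

/-- `[t]_h = [t / h] h`, with `[·]` the greatest integer function. -/
noncomputable def gridFloor (h t : ℝ) : ℝ := (⌊t / h⌋ : ℝ) * h

/-- `z` solves the equation with piecewise constant argument
`z'(t) = -a(t) z([t - [r([t]_h)]_h]_h)`, `t ≥ 0`, with `z(nh) = φ(nh)` at the grid points
`nh ∈ [-q, 0]`; here `'` is the right-hand derivative and `z` is continuous on `[0, ∞)`. -/
structure IsPCASolution (q : ℝ) (a r φ : ℝ → ℝ) (h : ℝ) (z : ℝ → ℝ) : Prop where
  initial : ∀ n : ℤ, -q ≤ n * h → n * h ≤ 0 → z (n * h) = φ (n * h)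
  continuousOn : ContinuousOn z (Set.Ici 0)
  hasDeriv : ∀ t, 0 ≤ t → HasDerivWithinAt z
    (-(a t * z (gridFloor h (t - gridFloor h (r (gridFloor h t)))))) (Set.Ici t) t

/-- `z` solves `z(n+1) = z(n) - (∫_{nh}^{(n+1)h} a) z(n - k_n)`, `k_n = [r(nh)/h]`, for `n ≥ m`. -/
def IsDifferenceSolution (a r : ℝ → ℝ) (h : ℝ) (m : ℤ) (z : ℤ → ℝ) : Prop :=
  ∀ n, m ≤ n →
    z (n + 1) = z n - (∫ s in (n * h : ℝ)..((n + 1) * h : ℝ), a s) * z (n - ⌊r (n * h) / h⌋)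

/-- The zero solution of the difference equation is uniformly asymptotically stable: uniformly
stable and uniformly attractive, with constants independent of the initial time `m ≥ 0`.
The initial data at time `m` are the values at the integers `j` with `m - q/h ≤ j ≤ m`. -/
def DifferenceUAS (q : ℝ) (a r : ℝ → ℝ) (h : ℝ) : Prop :=
  (∀ ε > 0, ∃ δ > 0, ∀ m : ℤ, 0 ≤ m → ∀ z, IsDifferenceSolution a r h m z →
    (∀ j, m - ⌊q / h⌋ ≤ j → j ≤ m → |z j| < δ) → ∀ n, m ≤ n → |z n| < ε) ∧
  (∃ b > 0, ∀ ε > 0, ∃ N : ℕ, ∀ m : ℤ, 0 ≤ m → ∀ z, IsDifferenceSolution a r h m z →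
    (∀ j, m - ⌊q / h⌋ ≤ j → j ≤ m → |z j| < b) → ∀ n, m + N ≤ n → |z n| < ε)

/-!
On the grid `hℤ` a solution `x` of the delay equation satisfies the difference equation up to an
error controlled by the oscillation of `x` between the exact delayed argument `u - r u` and the grid
point used in its place; these are uniformly close for small `h` because `r` is uniformly
continuous. A discrete Grönwall inequality turns this consistency error into a bound for the
distance between the two solutions on bounded time intervals. The solution with piecewise constant
argument restricts to a solution of the difference equation on the grid, so convergence follows from
the uniform continuity of `x` on compact intervals.

For stability the bound has to be uniform over all initial times and initial data at most `1`. After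
one delay length a solution `z` of the difference equation has a Lipschitz constant independent of
`h`, so a Lipschitz interpolation of `z` is the initial function of a solution of the delay equation
that is itself uniformly Lipschitz. By uniform attractivity that solution has decayed to `1 / 4`
after a fixed time, and for small `h` the solution `z` is within `1 / 4` of it. Hence each solution
of the difference equation is halved after a fixed number of steps, and iterating this by linearity
gives exponential decay.
-/

open MeasureTheory Set Filter Topology
open scoped NNReal BoundedContinuousFunction

section RightContinuous

theorem measurable_of_continuousWithinAt_Ici {β : Type*} [TopologicalSpace β]
    [TopologicalSpace.PseudoMetrizableSpace β] [MeasurableSpace β] [BorelSpace β] {f : ℝ → β}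
    (hf : ∀ t, ContinuousWithinAt f (Ici t) t) : Measurable f := by
  -- `f` is the pointwise limit of its compositions with the upper grid approximations `p n`.
  let p : ℕ → ℝ → ℝ := fun n t => ((⌊(n + 1 : ℝ) * t⌋ : ℝ) + 1) / (n + 1)
  have hp_meas (n : ℕ) : Measurable fun t => f (p n t) :=
    (measurable_of_countable fun k : ℤ => f (((k : ℝ) + 1) / (n + 1))).comp
      (Int.measurable_floor.comp (measurable_const.mul measurable_id))
  have hp_ge (t : ℝ) (n : ℕ) : t ≤ p n t := by
    rw [le_div_iff₀ (by positivity)]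
    linarith [Int.lt_floor_add_one ((n + 1 : ℝ) * t)]
  have hp_le (t : ℝ) (n : ℕ) : p n t ≤ t + 1 / (n + 1) := by
    rw [div_le_iff₀ (by positivity)]
    field_simp
    linarith [Int.floor_le ((n + 1 : ℝ) * t)]
  have hp_lim (t : ℝ) : Tendsto (p · t) atTop (𝓝 t) :=
    tendsto_of_tendsto_of_tendsto_of_le_of_le tendsto_const_nhds
      (by simpa using (tendsto_one_div_add_atTop_nhds_zero_nat (𝕜 := ℝ)).const_add t)
      (hp_ge t) (hp_le t)
  exact measurable_of_tendsto_metrizable hp_meas <| tendsto_pi_nhds.2 fun t =>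
    (hf t).tendsto.comp (tendsto_nhdsWithin_iff.2 ⟨hp_lim t, .of_forall (hp_ge t)⟩)

theorem intervalIntegrable_of_continuousWithinAt_Ici_of_bound {E : Type*} [NormedAddCommGroup E]
    [MeasurableSpace E] [BorelSpace E] [SecondCountableTopology E] {f : ℝ → E} {M : ℝ}
    (hf : ∀ t, ContinuousWithinAt f (Ici t) t) (hM : ∀ t, ‖f t‖ ≤ M) (c d : ℝ) :
    IntervalIntegrable f volume c d :=
  (intervalIntegrable_const (c := M)).mono_fun
    (measurable_of_continuousWithinAt_Ici hf).aestronglyMeasurable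
    (.of_forall fun t => (hM t).trans (le_abs_self M))

theorem hasDerivWithinAt_Ici_integral {E : Type*} [NormedAddCommGroup E] [NormedSpace ℝ E]
    [CompleteSpace E] [MeasurableSpace E] [BorelSpace E] [SecondCountableTopology E] {f : ℝ → E}
    {c t : ℝ} (hf : ∀ t, ContinuousWithinAt f (Ici t) t) (hint : IntervalIntegrable f volume c t) :
    HasDerivWithinAt (fun u => ∫ v in c..u, f v) (f t) (Ici t) t :=
  intervalIntegral.integral_hasDerivWithinAt_right hint
    (measurable_of_continuousWithinAt_Ici hf).stronglyMeasurable.stronglyMeasurableAtFilter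
    ((hf t).mono Ioi_subset_Ici_self)

end RightContinuous

section Lipschitz

theorem lipschitzWith_of_Iic_of_Ici {β : Type*} [PseudoMetricSpace β] {f : ℝ → β} {K : ℝ≥0}
    {s : ℝ} (hl : LipschitzOnWith K f (Iic s)) (hr : LipschitzOnWith K f (Ici s)) :
    LipschitzWith K f := by
  have across {u v : ℝ} (hu : u ≤ s) (hv : s ≤ v) : dist (f u) (f v) ≤ K * dist u v := by
    have hsplit : dist u v = dist u s + dist s v := by
      simp only [Real.dist_eq, abs_of_nonpos (sub_nonpos.2 hu), abs_of_nonpos (sub_nonpos.2 hv),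
        abs_of_nonpos (sub_nonpos.2 (hu.trans hv))]
      ring
    calc dist (f u) (f v) ≤ dist (f u) (f s) + dist (f s) (f v) := dist_triangle _ _ _
      _ ≤ K * dist u s + K * dist s v :=
        add_le_add (hl.dist_le_mul u hu s self_mem_Iic) (hr.dist_le_mul s self_mem_Ici v hv)
      _ = K * dist u v := by rw [hsplit, mul_add]
  refine .of_dist_le_mul fun u v => ?_
  rcases le_total u s with hu | hu <;> rcases le_total v s with hv | hv
  · exact hl.dist_le_mul u hu v hv
  · exact across hu hv
  · rw [dist_comm, dist_comm u]
    exact across hv hu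
  · exact hr.dist_le_mul u hu v hv

theorem lipschitzOnWith_Ici_of_norm_deriv_right_le {E : Type*} [NormedAddCommGroup E]
    [NormedSpace ℝ E] {f f' : ℝ → E} {K : ℝ≥0} {s : ℝ} (hf : ContinuousOn f (Ici s))
    (hf' : ∀ t, s ≤ t → HasDerivWithinAt f (f' t) (Ici t) t) (hK : ∀ t, s ≤ t → ‖f' t‖ ≤ K) :
    LipschitzOnWith K f (Ici s) := by
  have ordered {u v : ℝ} (hu : s ≤ u) (huv : u ≤ v) : dist (f v) (f u) ≤ K * dist v u := by
    rw [dist_eq_norm, Real.dist_eq, abs_of_nonneg (sub_nonneg.2 huv)]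
    exact norm_image_sub_le_of_norm_deriv_right_le_segment
      (hf.mono (Icc_subset_Ici_self.trans (Ici_subset_Ici.2 hu)))
      (fun t ht => hf' t (hu.trans ht.1)) (fun t ht => hK t (hu.trans ht.1)) v
      (right_mem_Icc.2 huv)
  refine .of_dist_le_mul fun u hu v hv => ?_
  rcases le_total u v with huv | hvu
  · rw [dist_comm, dist_comm u]
    exact ordered hu huv
  · exact ordered hv hvu

theorem exists_boundedContinuousFunction_lipschitzWith_extension {X : Type*} [PseudoMetricSpace X]
    {f : X → ℝ} {S : Set X} {K C : ℝ≥0} (hf : LipschitzOnWith K f S) (hC : ∀ x ∈ S, |f x| ≤ C) :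
    ∃ ψ : X →ᵇ ℝ, LipschitzWith K ψ ∧ (∀ x, |ψ x| ≤ C) ∧ EqOn ψ f S := by
  obtain ⟨g, hg, hgf⟩ := hf.extend_real
  have hclip : LipschitzWith K fun x => max (-C : ℝ) (min C (g x)) :=
    (hg.const_min (C : ℝ)).const_max (-C : ℝ)
  have hbound (x : X) : |max (-C : ℝ) (min C (g x))| ≤ C :=
    abs_le.2 ⟨le_max_left _ _, max_le (by linarith [C.2]) (min_le_left _ _)⟩
  refine ⟨.ofNormedAddCommGroup _ hclip.continuous C hbound, hclip, hbound, fun x hx => ?_⟩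
  have h := abs_le.1 (hC x hx)
  change max (-C : ℝ) (min C (g x)) = f x
  rw [← hgf hx, min_eq_right h.2, max_eq_right h.1]

end Lipschitz

section Existence

variable {a r : ℝ → ℝ} {M : ℝ≥0} {s : ℝ}

/-- Weight of the Bielecki norm in which the Volterra operator of the delay equation, started at
time `s` with a coefficient bounded by `M`, has norm at most `1 / 2`. -/
noncomputable def bieleckiWeight (M s t : ℝ) : ℝ := Real.exp (2 * M * max (t - s) 0)

namespace bieleckiWeight

theorem pos (M s t : ℝ) : 0 < bieleckiWeight M s t := Real.exp_pos _

theorem one_le (M : ℝ≥0) (s t : ℝ) : 1 ≤ bieleckiWeight M s t := Real.one_le_exp (by positivity)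

theorem continuous (M s : ℝ) : Continuous (bieleckiWeight M s) := by
  unfold bieleckiWeight
  fun_prop

theorem monotone (M : ℝ≥0) (s : ℝ) : Monotone (bieleckiWeight M s) := fun t u h => by
  unfold bieleckiWeight
  gcongr

theorem integral_eq (M s t : ℝ) :
    2 * M * ∫ u in s..max t s, bieleckiWeight M s u = bieleckiWeight M s t - 1 := by
  have hexp (u : ℝ) : HasDerivAt (fun u => Real.exp (2 * M * (u - s)))
      (2 * M * Real.exp (2 * M * (u - s))) u :=
    ((((hasDerivAt_id' u).sub_const s).const_mul (2 * M)).exp).congr_deriv (by ring)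
  have hweight : EqOn (bieleckiWeight M s) (fun u => Real.exp (2 * M * (u - s)))
      (uIcc s (max t s)) := fun u hu => by
    rw [uIcc_of_le (le_max_right t s)] at hu
    simp only [bieleckiWeight, max_eq_left (sub_nonneg.2 hu.1)]
  rw [intervalIntegral.integral_congr hweight, ← intervalIntegral.integral_const_mul,
    intervalIntegral.integral_eq_sub_of_hasDerivAt (fun u _ => hexp u)
      (Continuous.intervalIntegrable (by fun_prop) _ _), bieleckiWeight, ← max_sub_sub_right]
  simp

end bieleckiWeight

theorem abs_integral_bieleckiWeight_delay_le {y : ℝ → ℝ} {B : ℝ} (hM : ∀ t, |a t| ≤ M)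
    (hr : ∀ t, 0 ≤ r t) (hB : ∀ t, |y t| ≤ B) (t : ℝ) :
    |∫ u in s..max t s, a u * (bieleckiWeight M s (u - r u) * y (u - r u))|
      ≤ B / 2 * bieleckiWeight M s t := by
  have hB₀ : 0 ≤ B := (abs_nonneg _).trans (hB 0)
  have hpt (u : ℝ) : ‖a u * (bieleckiWeight M s (u - r u) * y (u - r u))‖
      ≤ M * B * bieleckiWeight M s u := by
    have hw : bieleckiWeight M s (u - r u) ≤ bieleckiWeight M s u :=
      bieleckiWeight.monotone M s (sub_le_self u (hr u))
    rw [norm_mul, norm_mul, Real.norm_of_nonneg (bieleckiWeight.pos _ _ _).le]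
    calc ‖a u‖ * (bieleckiWeight M s (u - r u) * ‖y (u - r u)‖)
        ≤ M * (bieleckiWeight M s u * B) := by
          have := bieleckiWeight.pos M s
          gcongr
          exacts [mul_nonneg (this _).le (norm_nonneg _), hM u, (this _).le, hB _]
      _ = M * B * bieleckiWeight M s u := by ring
  calc |∫ u in s..max t s, a u * (bieleckiWeight M s (u - r u) * y (u - r u))|
      ≤ ∫ u in s..max t s, M * B * bieleckiWeight M s u :=
        intervalIntegral.norm_integral_le_of_norm_le (le_max_right t s)
          (.of_forall fun u _ => hpt u)
          (((bieleckiWeight.continuous M s).const_mul _).intervalIntegrable _ _)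
    _ = B / 2 * (bieleckiWeight M s t - 1) := by
        rw [intervalIntegral.integral_const_mul, ← bieleckiWeight.integral_eq]
        ring
    _ ≤ B / 2 * bieleckiWeight M s t := by
        gcongr
        linarith

theorem exists_add_apply_eq_of_norm_lt_one {E : Type*} [NormedAddCommGroup E] [NormedSpace ℝ E]
    [CompleteSpace E] {V : E →L[ℝ] E} (hV : ‖V‖ < 1) (f : E) : ∃ y, y + V y = f := by
  obtain ⟨U, hU⟩ : IsUnit (1 + V) := by
    simpa using isUnit_one_sub_of_norm_lt_one (x := -V) (by rwa [norm_neg])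
  refine ⟨U.inv f, ?_⟩
  have h : (1 + V) * U.inv = 1 := hU ▸ U.mul_inv
  exact congrArg (fun W : E →L[ℝ] E => W f) h

theorem exists_weighted_volterra_operator (hint : ∀ c d, IntervalIntegrable a volume c d)
    (hM : ∀ t, |a t| ≤ M) (hr : ∀ t, 0 ≤ r t) (hrc : Continuous r) (s : ℝ) :
    ∃ V : (ℝ →ᵇ ℝ) →L[ℝ] (ℝ →ᵇ ℝ), ‖V‖ ≤ 1 / 2 ∧ ∀ y t, V y t = (bieleckiWeight M s t)⁻¹ *
      ∫ u in s..max t s, a u * (bieleckiWeight M s (u - r u) * y (u - r u)) := by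
  set w := bieleckiWeight M s
  have hwc : Continuous w := bieleckiWeight.continuous M s
  have hwpos (t : ℝ) : 0 < w t := bieleckiWeight.pos M s t
  let I (y : ℝ →ᵇ ℝ) (t : ℝ) : ℝ := ∫ u in s..max t s, a u * (w (u - r u) * y (u - r u))
  have hIint (y : ℝ →ᵇ ℝ) (c d : ℝ) :
      IntervalIntegrable (fun u => a u * (w (u - r u) * y (u - r u))) volume c d :=
    (hint c d).mul_continuousOn (by fun_prop)
  have hcont (y : ℝ →ᵇ ℝ) : Continuous fun t => (w t)⁻¹ * I y t :=
    (hwc.inv₀ fun t => (hwpos t).ne').mul <|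
      (intervalIntegral.continuous_primitive (hIint y) s).comp (continuous_id.max continuous_const)
  have hbound (y : ℝ →ᵇ ℝ) (t : ℝ) : ‖(w t)⁻¹ * I y t‖ ≤ 1 / 2 * ‖y‖ := by
    rw [norm_mul, norm_inv, Real.norm_of_nonneg (hwpos t).le, inv_mul_le_iff₀ (hwpos t)]
    exact (abs_integral_bieleckiWeight_delay_le hM hr y.norm_coe_le_norm t).trans_eq (by ring)
  let V : (ℝ →ᵇ ℝ) →ₗ[ℝ] (ℝ →ᵇ ℝ) :=
    { toFun y := .ofNormedAddCommGroup (fun t => (w t)⁻¹ * I y t) (hcont y) _ (hbound y)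
      map_add' y₁ y₂ := by
        ext t
        change (w t)⁻¹ * I (y₁ + y₂) t = (w t)⁻¹ * I y₁ t + (w t)⁻¹ * I y₂ t
        simp only [I, BoundedContinuousFunction.add_apply, mul_add]
        rw [intervalIntegral.integral_add (hIint y₁ _ _) (hIint y₂ _ _), mul_add]
      map_smul' c y := by
        ext t
        change (w t)⁻¹ * I (c • y) t = c * ((w t)⁻¹ * I y t)
        simp only [I, BoundedContinuousFunction.smul_apply, smul_eq_mul, mul_left_comm _ c]
        rw [intervalIntegral.integral_const_mul, mul_left_comm] }
  refine ⟨V.mkContinuous (1 / 2) fun y => ?_, V.mkContinuous_norm_le (by norm_num) _,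
    fun y t => rfl⟩
  exact BoundedContinuousFunction.norm_ofNormedAddCommGroup_le _ (by positivity) (hbound y)

theorem exists_continuous_integral_delay_eq (hint : ∀ c d, IntervalIntegrable a volume c d)
    (hM : ∀ t, |a t| ≤ M) (hr : ∀ t, 0 ≤ r t) (hrc : Continuous r) (s : ℝ) (ψ : ℝ →ᵇ ℝ) :
    ∃ x : ℝ → ℝ, Continuous x ∧
      ∀ t, x t = ψ (min t s) - ∫ u in s..max t s, a u * x (u - r u) := by
  obtain ⟨V, hV, hVy⟩ := exists_weighted_volterra_operator hint hM hr hrc s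
  set w := bieleckiWeight M s
  have hwc : Continuous w := bieleckiWeight.continuous M s
  have hwpos (t : ℝ) : 0 < w t := bieleckiWeight.pos M s t
  have hf_bound (t : ℝ) : ‖(w t)⁻¹ * ψ (min t s)‖ ≤ ‖ψ‖ := by
    rw [norm_mul, norm_inv, Real.norm_of_nonneg (hwpos t).le, inv_mul_le_iff₀ (hwpos t)]
    exact (ψ.norm_coe_le_norm _).trans
      (le_mul_of_one_le_left (norm_nonneg _) (bieleckiWeight.one_le M s t))
  let f : ℝ →ᵇ ℝ := .ofNormedAddCommGroup (fun t => (w t)⁻¹ * ψ (min t s))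
    ((hwc.inv₀ fun t => (hwpos t).ne').mul (by fun_prop)) ‖ψ‖ hf_bound
  obtain ⟨y, hy⟩ := exists_add_apply_eq_of_norm_lt_one (hV.trans_lt one_half_lt_one) f
  refine ⟨fun t => w t * y t, hwc.mul y.continuous, fun t => ?_⟩
  have hyt : y t + V y t = (w t)⁻¹ * ψ (min t s) := congrArg (fun g : ℝ →ᵇ ℝ => g t) hy
  have hcancel := congrArg (w t * ·) hyt
  simp only [hVy, mul_add, mul_inv_cancel_left₀ (hwpos t).ne'] at hcancel
  exact eq_sub_of_add_eq hcancel

end Existence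

section DelayEquation

variable {q s : ℝ} {a r x : ℝ → ℝ} {M : ℝ≥0}

theorem abs_sub_add_integral_mul_le {y p : ℝ → ℝ} {c d ζ B : ℝ}
    (ha : ∀ t, ContinuousWithinAt a (Ici t) t) (hM : ∀ t, |a t| ≤ M) (hcd : c ≤ d)
    (hyc : ContinuousOn y (Icc c d))
    (hy : ∀ u ∈ Ico c d, HasDerivWithinAt y (-(a u * p u)) (Ici u) u)
    (hp : ∀ u ∈ Ico c d, |p u - ζ| ≤ B) :
    |y d - y c + (∫ u in c..d, a u) * ζ| ≤ M * B * (d - c) := by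
  have hint (c d : ℝ) : IntervalIntegrable a volume c d :=
    intervalIntegrable_of_continuousWithinAt_Ici_of_bound ha hM c d
  let F (u : ℝ) : ℝ := y u + (∫ v in c..u, a v) * ζ
  have hFc : ContinuousOn F (Icc c d) :=
    hyc.add ((intervalIntegral.continuous_primitive hint c).mul_const ζ).continuousOn
  have hF (u : ℝ) (hu : u ∈ Ico c d) : HasDerivWithinAt F (-(a u * (p u - ζ))) (Ici u) u :=
    ((hy u hu).add ((hasDerivWithinAt_Ici_integral ha (hint c u)).mul_const ζ)).congr_deriv
      (by ring)
  have hbound (u : ℝ) (hu : u ∈ Ico c d) : ‖-(a u * (p u - ζ))‖ ≤ M * B := by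
    rw [norm_neg, norm_mul]
    exact mul_le_mul (hM u) (hp u hu) (abs_nonneg _) M.2
  have hsub := norm_image_sub_le_of_norm_deriv_right_le_segment hFc hF hbound d
    (right_mem_Icc.2 hcd)
  simpa only [F, intervalIntegral.integral_same, zero_mul, add_zero, Real.norm_eq_abs,
    add_sub_right_comm] using hsub

theorem exists_isDelaySolution (ha : ∀ t, ContinuousWithinAt a (Ici t) t) (hM : ∀ t, |a t| ≤ M)
    (hr : ∀ t, 0 ≤ r t) (hrc : Continuous r) (q s : ℝ) (ψ : ℝ →ᵇ ℝ) :
    ∃ x, IsDelaySolution q a r s x ∧ EqOn x ψ (Iic s) := by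
  have hint (c d : ℝ) : IntervalIntegrable a volume c d :=
    intervalIntegrable_of_continuousWithinAt_Ici_of_bound ha hM c d
  obtain ⟨x, hxc, hx⟩ := exists_continuous_integral_delay_eq hint hM hr hrc s ψ
  have hxd : Continuous fun u => x (u - r u) := by fun_prop
  have hx_after (t : ℝ) (ht : s ≤ t) : x t = ψ s - ∫ u in s..t, a u * x (u - r u) := by
    rw [hx t, min_eq_right ht, max_eq_left ht]
  refine ⟨x, ⟨hxc.continuousOn, fun t ht => ?_⟩, fun t ht => ?_⟩
  · exact ((hasDerivWithinAt_Ici_integral (fun u => (ha u).mul hxd.continuousWithinAt)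
      ((hint s t).mul_continuousOn hxd.continuousOn)).const_sub (ψ s)).congr
      (fun u hu => hx_after u (ht.trans hu)) (hx_after t ht)
  · rw [hx t, min_eq_left ht, max_eq_right ht, intervalIntegral.integral_same, sub_zero]

theorem IsDelaySolution.congr {a' r' : ℝ → ℝ} (hx : IsDelaySolution q a r s x)
    (ha : EqOn a a' (Ici s)) (hr : EqOn r r' (Ici s)) : IsDelaySolution q a' r' s x :=
  ⟨hx.continuousOn, fun t ht => by simpa only [ha ht, hr ht] using hx.hasDeriv t ht⟩

theorem IsDelaySolution.const_mul (hx : IsDelaySolution q a r s x) (c : ℝ) :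
    IsDelaySolution q a r s fun t => c * x t where
  continuousOn := continuousOn_const.mul hx.continuousOn
  hasDeriv t ht := ((hx.hasDeriv t ht).const_mul c).congr_deriv (by ring)

theorem IsDelaySolution.lipschitzOnWith {B : ℝ≥0} (hx : IsDelaySolution q a r s x)
    (hM : ∀ t, |a t| ≤ M) (hr : ∀ t, r t ∈ Icc 0 q) (hB : ∀ t, s - q ≤ t → |x t| ≤ B) :
    LipschitzOnWith (M * B) x (Ici s) := by
  have hq : 0 ≤ q := (hr 0).1.trans (hr 0).2
  refine lipschitzOnWith_Ici_of_norm_deriv_right_le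
    (hx.continuousOn.mono (Ici_subset_Ici.2 (sub_le_self s hq))) hx.hasDeriv fun t ht => ?_
  rw [norm_neg, norm_mul]
  exact mul_le_mul (hM t) (hB _ (sub_le_sub ht (hr t).2)) (abs_nonneg _) M.2

theorem IsDelaySolution.abs_le_of_forall_abs_lt {δ ε C t : ℝ} (hδ : 0 < δ) (hC : 0 < C)
    (hsmall : ∀ y, IsDelaySolution q a r s y → (∀ u ∈ Icc (s - q) s, |y u| < δ) → |y t| < ε)
    (hx : IsDelaySolution q a r s x) (hxC : ∀ u ∈ Icc (s - q) s, |x u| ≤ C) :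
    |x t| ≤ 2 * C / δ * ε := by
  have hc : 0 < δ / (2 * C) := by positivity
  have hscaled := hsmall _ (hx.const_mul (δ / (2 * C))) fun u hu => by
    rw [abs_mul, abs_of_pos hc]
    calc δ / (2 * C) * |x u| ≤ δ / (2 * C) * C := by gcongr; exact hxC u hu
      _ = δ / 2 := by field_simp
      _ < δ := half_lt_self hδ
  rw [abs_mul, abs_of_pos hc, ← lt_div_iff₀' hc] at hscaled
  exact hscaled.le.trans_eq (by field_simp)

theorem DelayUAS.congr {a' r' : ℝ → ℝ} (h : DelayUAS q a r) (ha : EqOn a a' (Ici 0))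
    (hr : EqOn r r' (Ici 0)) : DelayUAS q a' r' := by
  have hsol {s : ℝ} (hs : 0 ≤ s) {x : ℝ → ℝ} (hx : IsDelaySolution q a' r' s x) :
      IsDelaySolution q a r s x :=
    hx.congr (ha.symm.mono (Ici_subset_Ici.2 hs)) (hr.symm.mono (Ici_subset_Ici.2 hs))
  obtain ⟨hstable, b, hb, hattr⟩ := h
  refine ⟨fun ε hε => ?_, b, hb, fun ε hε => ?_⟩
  · obtain ⟨δ, hδ, hδε⟩ := hstable ε hε
    exact ⟨δ, hδ, fun s hs x hx => hδε s hs x (hsol hs hx)⟩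
  · obtain ⟨T, hT, hTε⟩ := hattr ε hε
    exact ⟨T, hT, fun s hs x hx => hTε s hs x (hsol hs hx)⟩

theorem DelayUAS.exists_uniform_bound (h : DelayUAS q a r) {C : ℝ≥0} (hC : 0 < C) :
    ∃ K ≥ C, ∀ s, 0 ≤ s → ∀ x, IsDelaySolution q a r s x →
      (∀ t ∈ Icc (s - q) s, |x t| ≤ C) → ∀ t, s - q ≤ t → |x t| ≤ K := by
  obtain ⟨δ, hδ, hδ₁⟩ := h.1 1 one_pos
  refine ⟨max C (2 * C / ⟨δ, hδ.le⟩), le_max_left _ _, fun s hs x hx hxC t ht => ?_⟩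
  rw [NNReal.coe_max]
  rcases le_total t s with hts | hst
  · exact (hxC t ⟨ht, hts⟩).trans (le_max_left _ _)
  · refine le_max_of_le_right ?_
    exact (hx.abs_le_of_forall_abs_lt hδ hC (fun y hy hyδ => hδ₁ s hs y hy hyδ t hst) hxC).trans_eq
      (mul_one _)

theorem DelayUAS.exists_decay_time (h : DelayUAS q a r) {C κ : ℝ} (hC : 0 < C) (hκ : 0 < κ) :
    ∃ T > 0, ∀ s, 0 ≤ s → ∀ x, IsDelaySolution q a r s x →
      (∀ t ∈ Icc (s - q) s, |x t| ≤ C) → ∀ t, s + T ≤ t → |x t| ≤ κ := by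
  obtain ⟨b, hb, hattr⟩ := h.2
  obtain ⟨T, hT, hTκ⟩ := hattr (b * κ / (2 * C)) (by positivity)
  refine ⟨T, hT, fun s hs x hx hxC t ht => ?_⟩
  exact (hx.abs_le_of_forall_abs_lt hb hC (fun y hy hyb => hTκ s hs y hy hyb t ht) hxC).trans_eq
    (by field_simp)

end DelayEquation

section Grid

/-- The index `n - k_n`, `k_n = [r(nh)/h]`, of the grid point at which the difference equation
evaluates the delayed term in its `n`-th step. -/
noncomputable def delayedNode (r : ℝ → ℝ) (h : ℝ) (n : ℤ) : ℤ := n - ⌊r (n * h) / h⌋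

theorem delayedNode_mem_Icc {q h : ℝ} {r : ℝ → ℝ} {n : ℤ} (hh : 0 < h)
    (hr : r (n * h) ∈ Icc 0 q) : delayedNode r h n ∈ Icc (n - ⌊q / h⌋) n := by
  refine ⟨sub_le_sub_left (Int.floor_le_floor ?_) n, sub_le_self n (Int.floor_nonneg.2 ?_)⟩
  · exact div_le_div_of_nonneg_right hr.2 hh.le
  · exact div_nonneg hr.1 hh.le

theorem gridFloor_le {h : ℝ} (hh : 0 < h) (t : ℝ) : gridFloor h t ≤ t :=
  (le_div_iff₀ hh).1 (Int.floor_le (t / h))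

theorem lt_gridFloor_add {h : ℝ} (hh : 0 < h) (t : ℝ) : t < gridFloor h t + h := by
  have := (div_lt_iff₀ hh).1 (Int.lt_floor_add_one (t / h))
  rwa [add_one_mul] at this

theorem gridFloor_nonneg {h t : ℝ} (hh : 0 < h) (ht : 0 ≤ t) : 0 ≤ gridFloor h t :=
  mul_nonneg (Int.cast_nonneg (Int.floor_nonneg.2 (div_nonneg ht hh.le))) hh.le

theorem gridFloor_of_mem_Ico {h t : ℝ} {j : ℤ} (hh : 0 < h) (ht : t ∈ Ico (j * h) ((j + 1) * h)) :
    gridFloor h t = j * h := by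
  rw [gridFloor, Int.floor_eq_iff.2 ⟨(le_div_iff₀ hh).2 ht.1, (div_lt_iff₀ hh).2 ht.2⟩]

theorem intCast_mul_mem_Icc_sub {q h : ℝ} {j n : ℤ} (hh : 0 < h) (hj : j ∈ Icc (n - ⌊q / h⌋) n) :
    (j * h : ℝ) ∈ Icc (n * h - q) (n * h) := by
  refine ⟨?_, mul_le_mul_of_nonneg_right (Int.cast_le.2 hj.2) hh.le⟩
  calc (n * h - q : ℝ) ≤ n * h - gridFloor h q := sub_le_sub_left (gridFloor_le hh q) _
    _ = (n - ⌊q / h⌋ : ℤ) * h := by rw [gridFloor, Int.cast_sub, sub_mul]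
    _ ≤ j * h := mul_le_mul_of_nonneg_right (Int.cast_le.2 hj.1) hh.le

theorem eventually_abs_delayedNode_sub_lt {r : ℝ → ℝ} (hr : UniformContinuous r) {η : ℝ}
    (hη : 0 < η) : ∀ᶠ h : ℝ in 𝓝[>] 0, ∀ n : ℤ, ∀ u ∈ Icc (n * h) ((n + 1) * h),
      |u - r u - delayedNode r h n * h| < η := by
  obtain ⟨δ, hδ, hrδ⟩ := Metric.uniformContinuous_iff.1 hr (η / 2) (half_pos hη)
  filter_upwards [Ioo_mem_nhdsGT (lt_min hδ (half_pos hη))] with h ⟨hh, hlt⟩ n u hu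
  obtain ⟨hhδ, hhη⟩ := lt_min_iff.1 hlt
  rw [add_one_mul] at hu
  have hrn : |r u - r (n * h)| < η / 2 :=
    hrδ (abs_sub_lt_iff.2 ⟨by linarith [hu.2], by linarith [hu.1]⟩)
  have hle := gridFloor_le hh (r (n * h))
  have hlt := lt_gridFloor_add hh (r (n * h))
  have hnode : (delayedNode r h n : ℝ) * h = n * h - gridFloor h (r (n * h)) := by
    rw [delayedNode, gridFloor, Int.cast_sub, sub_mul]
  rw [hnode, abs_sub_lt_iff]
  constructor <;> linarith [hu.1, hu.2, abs_sub_lt_iff.1 hrn]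

end Grid

section DifferenceEquation

theorem norm_le_of_delay_step {E : Type*} [SeminormedAddCommGroup E] {e : ℤ → E} {m L : ℤ}
    {K A ω : ℝ} (hL : 0 ≤ L) (hK : 0 ≤ K) (hω : 0 ≤ ω) (hini : ∀ j ∈ Icc (m - L) m, ‖e j‖ ≤ A)
    (N : ℕ) (hstep : ∀ n ∈ Ico m (m + N), ∀ B, (∀ j ∈ Icc (n - L) n, ‖e j‖ ≤ B) →
      ‖e (n + 1) - e n‖ ≤ K * (B + ω)) :
    ∀ j ∈ Icc (m - L) (m + N), ‖e j‖ ≤ (A + ω) * Real.exp (K * N) - ω := by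
  have hA : 0 ≤ A := (norm_nonneg _).trans (hini m ⟨sub_le_self m hL, le_rfl⟩)
  induction N with
  | zero => simpa using hini
  | succ N ih =>
    specialize ih fun n hn => hstep n ⟨hn.1, by have := hn.2; push_cast; omega⟩
    set B := (A + ω) * Real.exp (K * N) - ω with hB
    have hgrow : B + K * (B + ω) ≤ (A + ω) * Real.exp (K * (N + 1 : ℕ)) - ω := by
      calc B + K * (B + ω) = (A + ω) * (Real.exp (K * N) * (K + 1)) - ω := by rw [hB]; ring
        _ ≤ (A + ω) * (Real.exp (K * N) * Real.exp K) - ω := by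
          gcongr
          exact Real.add_one_le_exp K
        _ = (A + ω) * Real.exp (K * (N + 1 : ℕ)) - ω := by
          rw [← Real.exp_add, Nat.cast_succ, mul_add_one]
    intro j ⟨hj₁, hj₂⟩
    refine le_trans ?_ hgrow
    rcases (show j ≤ m + N ∨ j = m + N + 1 by push_cast at hj₂; omega) with hj | rfl
    · have hBω : 0 ≤ B + ω := by
        rw [hB, sub_add_cancel]
        positivity
      exact (ih j ⟨hj₁, hj⟩).trans (le_add_of_nonneg_right (mul_nonneg hK hBω))
    · calc ‖e (m + N + 1)‖ ≤ ‖e (m + N)‖ + ‖e (m + N + 1) - e (m + N)‖ := norm_le_insert' _ _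
        _ ≤ B + K * (B + ω) := by
          refine add_le_add (ih _ ⟨by omega, le_rfl⟩) (hstep _ ⟨by omega, by push_cast; omega⟩ B ?_)
          exact fun j hj => ih j ⟨by have := hj.1; omega, hj.2⟩

variable {q h : ℝ} {a r : ℝ → ℝ} {M : ℝ≥0} {m : ℤ} {z : ℤ → ℝ}

theorem IsDifferenceSolution.congr {a' r' : ℝ → ℝ} (hh : 0 ≤ h)
    (hz : IsDifferenceSolution a r h m z) (ha : EqOn a a' (Ici (m * h)))
    (hr : EqOn r r' (Ici (m * h))) : IsDifferenceSolution a' r' h m z := fun n hn => by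
  have hmn : (m : ℝ) * h ≤ n * h := mul_le_mul_of_nonneg_right (Int.cast_le.2 hn) hh
  have hint : ∫ u in (n * h : ℝ)..((n + 1) * h), a u = ∫ u in (n * h : ℝ)..((n + 1) * h), a' u :=
    intervalIntegral.integral_congr fun u hu => by
      rw [uIcc_of_le (by linarith)] at hu
      exact ha (hmn.trans hu.1)
  rw [hz n hn, hint, hr hmn]

theorem DifferenceUAS.congr {a' r' : ℝ → ℝ} (hh : 0 ≤ h) (hUAS : DifferenceUAS q a r h)
    (ha : EqOn a a' (Ici 0)) (hr : EqOn r r' (Ici 0)) : DifferenceUAS q a' r' h := by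
  have hsol {m : ℤ} (hm : 0 ≤ m) {z : ℤ → ℝ} (hz : IsDifferenceSolution a' r' h m z) :
      IsDifferenceSolution a r h m z := by
    have hsub : Ici (m * h : ℝ) ⊆ Ici 0 := Ici_subset_Ici.2 (mul_nonneg (Int.cast_nonneg hm) hh)
    exact hz.congr hh (ha.symm.mono hsub) (hr.symm.mono hsub)
  obtain ⟨hstable, b, hb, hattr⟩ := hUAS
  refine ⟨fun ε hε => ?_, b, hb, fun ε hε => ?_⟩
  · obtain ⟨δ, hδ, hδε⟩ := hstable ε hε
    exact ⟨δ, hδ, fun m hm z hz => hδε m hm z (hsol hm hz)⟩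
  · obtain ⟨N, hNε⟩ := hattr ε hε
    exact ⟨N, fun m hm z hz => hNε m hm z (hsol hm hz)⟩

namespace IsDifferenceSolution

theorem mono (hz : IsDifferenceSolution a r h m z) {m' : ℤ} (hm : m ≤ m') :
    IsDifferenceSolution a r h m' z := fun n hn => hz n (hm.trans hn)

theorem const_mul (hz : IsDifferenceSolution a r h m z) (c : ℝ) :
    IsDifferenceSolution a r h m fun n => c * z n := fun n hn => by
  simp only [hz n hn]
  ring

theorem abs_succ_sub_le {n : ℤ} {B : ℝ} (hz : IsDifferenceSolution a r h m z) (hh : 0 ≤ h)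
    (hM : ∀ t, |a t| ≤ M) (hn : m ≤ n) (hB : |z (delayedNode r h n)| ≤ B) :
    |z (n + 1) - z n| ≤ M * h * B := by
  have hint : ‖∫ u in (n * h : ℝ)..((n + 1) * h), a u‖ ≤ M * h := by
    have hle : ‖∫ u in (n * h : ℝ)..((n + 1) * h), a u‖ ≤ M * |(n + 1) * h - n * h| :=
      intervalIntegral.norm_integral_le_of_norm_le_const fun u _ => hM u
    rwa [show ((n : ℝ) + 1) * h - n * h = h by ring, abs_of_nonneg hh] at hle
  rw [hz n hn, sub_sub_cancel_left, abs_neg, abs_mul]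
  exact mul_le_mul hint hB (abs_nonneg _) (by positivity)

theorem abs_le_mul_exp {A : ℝ} (hz : IsDifferenceSolution a r h m z) (hh : 0 < h)
    (hM : ∀ t, |a t| ≤ M) (hr : ∀ t, r t ∈ Icc 0 q) (hA : ∀ j ∈ Icc (m - ⌊q / h⌋) m, |z j| ≤ A)
    (N : ℕ) : ∀ j ∈ Icc (m - ⌊q / h⌋) (m + N), |z j| ≤ A * Real.exp (M * h * N) := by
  have hL : 0 ≤ ⌊q / h⌋ := Int.floor_nonneg.2 (div_nonneg ((hr 0).1.trans (hr 0).2) hh.le)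
  have hstep (n : ℤ) (hn : n ∈ Ico m (m + N)) (B : ℝ) (hB : ∀ j ∈ Icc (n - ⌊q / h⌋) n, |z j| ≤ B) :
      |z (n + 1) - z n| ≤ M * h * (B + 0) := by
    rw [add_zero]
    exact hz.abs_succ_sub_le hh.le hM hn.1 (hB _ (delayedNode_mem_Icc hh (hr _)))
  simpa only [add_zero, sub_zero, Real.norm_eq_abs] using
    norm_le_of_delay_step (e := z) (K := M * h) hL (by positivity) le_rfl hA N hstep

theorem lipschitzOnWith {l : ℤ} {B : ℝ≥0} (hz : IsDifferenceSolution a r h m z) (hh : 0 < h)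
    (hM : ∀ t, |a t| ≤ M) (hr : ∀ t, r t ∈ Icc 0 q) (hB : ∀ j ∈ Icc (m - ⌊q / h⌋) l, |z j| ≤ B) :
    LipschitzOnWith (M * B) (fun t => z ⌊t / h⌋) ((fun j : ℤ => (j * h : ℝ)) '' Icc m l) := by
  have ordered {i j : ℤ} (hi : m ≤ i) (hij : i ≤ j) (hj : j ≤ l) :
      |z j - z i| ≤ M * B * (j * h - i * h) := by
    induction j, hij using Int.leInduction with
    | base => simp
    | succ j hij ih =>
      have hnode := delayedNode_mem_Icc (n := j) hh (hr _)
      have hstep := hz.abs_succ_sub_le hh.le hM (hi.trans hij)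
        (hB _ ⟨by have := hnode.1; omega, by have := hnode.2; omega⟩)
      calc |z (j + 1) - z i| ≤ |z (j + 1) - z j| + |z j - z i| := abs_sub_le _ _ _
        _ ≤ M * h * B + M * B * (j * h - i * h) := add_le_add hstep (ih (by omega))
        _ = M * B * ((j + 1 : ℤ) * h - i * h) := by push_cast; ring
  refine .of_dist_le_mul ?_
  rintro _ ⟨i, hi, rfl⟩ _ ⟨j, hj, rfl⟩
  simp only [mul_div_cancel_right₀ _ hh.ne', Int.floor_intCast, Real.dist_eq]
  rcases le_total i j with hij | hji
  · rw [abs_sub_comm, abs_sub_comm ((i : ℝ) * h)]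
    exact (ordered hi.1 hij hj.2).trans
      (mul_le_mul_of_nonneg_left (le_abs_self _) (by positivity))
  · exact (ordered hj.1 hji hi.2).trans
      (mul_le_mul_of_nonneg_left (le_abs_self _) (by positivity))

theorem exists_lipschitzWith_interpolation {l : ℤ} {B : ℝ≥0} (hz : IsDifferenceSolution a r h m z)
    (hh : 0 < h) (hM : ∀ t, |a t| ≤ M) (hr : ∀ t, r t ∈ Icc 0 q)
    (hB : ∀ j ∈ Icc (m - ⌊q / h⌋) l, |z j| ≤ B) :
    ∃ ψ : ℝ →ᵇ ℝ, LipschitzWith (M * B) ψ ∧ (∀ t, |ψ t| ≤ B) ∧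
      ∀ j ∈ Icc m l, ψ (j * h) = z j := by
  have hL : 0 ≤ ⌊q / h⌋ := Int.floor_nonneg.2 (div_nonneg ((hr 0).1.trans (hr 0).2) hh.le)
  have hfloor (j : ℤ) : ⌊(j * h : ℝ) / h⌋ = j := by
    rw [mul_div_cancel_right₀ _ hh.ne', Int.floor_intCast]
  have hgrid : ∀ t ∈ (fun j : ℤ => (j * h : ℝ)) '' Icc m l, |z ⌊t / h⌋| ≤ B := by
    rintro _ ⟨j, hj, rfl⟩
    rw [hfloor]
    exact hB j ⟨by have := hj.1; omega, hj.2⟩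
  obtain ⟨ψ, hψ, hψB, hψz⟩ := exists_boundedContinuousFunction_lipschitzWith_extension
    (hz.lipschitzOnWith hh hM hr hB) hgrid
  refine ⟨ψ, hψ, hψB, fun j hj => ?_⟩
  simpa only [hfloor] using hψz (mem_image_of_mem (fun j : ℤ => (j * h : ℝ)) hj)

end IsDifferenceSolution

theorem abs_delaySolution_sub_differenceSolution_le {x : ℝ → ℝ} {ω : ℝ} {N : ℕ} (hh : 0 < h)
    (ha : ∀ t, ContinuousWithinAt a (Ici t) t) (hM : ∀ t, |a t| ≤ M) (hr : ∀ t, r t ∈ Icc 0 q)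
    (hx : IsDelaySolution q a r (m * h) x) (hz : IsDifferenceSolution a r h m z)
    (hini : ∀ j ∈ Icc (m - ⌊q / h⌋) m, x (j * h) = z j) (hω : 0 ≤ ω)
    (hxω : ∀ n ∈ Ico m (m + N), ∀ u ∈ Icc (n * h) ((n + 1) * h),
      |x (u - r u) - x (delayedNode r h n * h)| ≤ ω) :
    ∀ j ∈ Icc (m - ⌊q / h⌋) (m + N), |x (j * h) - z j| ≤ ω * (Real.exp (M * h * N) - 1) := by
  have hq : 0 ≤ q := (hr 0).1.trans (hr 0).2
  have hstep (n : ℤ) (hn : n ∈ Ico m (m + N)) (B : ℝ)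
      (hB : ∀ j ∈ Icc (n - ⌊q / h⌋) n, |x (j * h) - z j| ≤ B) :
      |x ((n + 1 : ℤ) * h) - z (n + 1) - (x (n * h) - z n)| ≤ M * h * (B + ω) := by
    have hmn : (m : ℝ) * h ≤ n * h := mul_le_mul_of_nonneg_right (Int.cast_le.2 hn.1) hh.le
    have hdelay (u : ℝ) (hu : u ∈ Ico (n * h) ((n + 1) * h)) :
        |x (u - r u) - z (delayedNode r h n)| ≤ ω + B :=
      (abs_sub_le _ _ _).trans
        (add_le_add (hxω n hn u (Ico_subset_Icc_self hu)) (hB _ (delayedNode_mem_Icc hh (hr _))))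
    have hcell := abs_sub_add_integral_mul_le ha hM (by linarith : (n * h : ℝ) ≤ (n + 1) * h)
      (hx.continuousOn.mono fun u hu => by have := hu.1; simp only [mem_Ici]; linarith)
      (fun u hu => hx.hasDeriv u (hmn.trans hu.1)) hdelay
    calc |x ((n + 1 : ℤ) * h) - z (n + 1) - (x (n * h) - z n)|
        = |x ((n + 1) * h) - x (n * h) +
            (∫ u in (n * h : ℝ)..((n + 1) * h), a u) * z (delayedNode r h n)| := by
          rw [hz n hn.1, delayedNode]
          push_cast
          congr 1
          ring
      _ ≤ M * (ω + B) * ((n + 1) * h - n * h) := hcell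
      _ = M * h * (B + ω) := by ring
  intro j hj
  have hini' (j : ℤ) (hj : j ∈ Icc (m - ⌊q / h⌋) m) : |x (j * h) - z j| ≤ 0 := by
    rw [hini j hj, sub_self, abs_zero]
  exact (norm_le_of_delay_step (e := fun j => x (j * h) - z j) (K := M * h)
    (Int.floor_nonneg.2 (div_nonneg hq hh.le)) (by positivity) hω hini' N hstep j hj).trans_eq
    (by ring)

end DifferenceEquation

section Convergence

variable {q h t : ℝ} {a r φ x : ℝ → ℝ} {M : ℝ≥0}

theorem IsPCASolution.congr {a' r' z : ℝ → ℝ} (hh : 0 < h) (hz : IsPCASolution q a r φ h z)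
    (ha : EqOn a a' (Ici 0)) (hr : EqOn r r' (Ici 0)) : IsPCASolution q a' r' φ h z where
  initial := hz.initial
  continuousOn := hz.continuousOn
  hasDeriv t ht := by simpa only [ha ht, hr (gridFloor_nonneg hh ht)] using hz.hasDeriv t ht

theorem IsPCASolution.isDifferenceSolution {z : ℝ → ℝ} (hh : 0 < h)
    (ha : ∀ t, ContinuousWithinAt a (Ici t) t) (hM : ∀ t, |a t| ≤ M)
    (hz : IsPCASolution q a r φ h z) : IsDifferenceSolution a r h 0 fun n => z (n * h) := by
  intro n hn
  have hn₀ : (0 : ℝ) ≤ n * h := mul_nonneg (Int.cast_nonneg hn) hh.le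
  have hnode (u : ℝ) (hu : u ∈ Ico (n * h) ((n + 1) * h)) :
      gridFloor h (u - gridFloor h (r (gridFloor h u))) = delayedNode r h n * h := by
    rw [gridFloor_of_mem_Ico hh hu]
    refine gridFloor_of_mem_Ico hh ?_
    rw [delayedNode, gridFloor]
    push_cast
    exact ⟨by linarith [hu.1], by linarith [hu.2]⟩
  have hcell := abs_sub_add_integral_mul_le (B := 0) (ζ := z (delayedNode r h n * h)) ha hM
    (by linarith : (n * h : ℝ) ≤ (n + 1) * h) (hz.continuousOn.mono fun u hu => hn₀.trans hu.1)
    (fun u hu => hz.hasDeriv u (hn₀.trans hu.1))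
    (fun u hu => by rw [hnode u hu, sub_self, abs_zero])
  rw [mul_zero, zero_mul, abs_nonpos_iff] at hcell
  rw [← delayedNode]
  push_cast
  linarith

theorem abs_delaySolution_sub_pcaSolution_le {z : ℝ → ℝ} {δ η : ℝ} (hh : 0 < h) (hδ : h < δ)
    (ha : ∀ t, ContinuousWithinAt a (Ici t) t) (hM : ∀ t, |a t| ≤ M) (hr : ∀ t, r t ∈ Icc 0 q)
    (hnode : ∀ n : ℤ, ∀ u ∈ Icc (n * h) ((n + 1) * h), |u - r u - delayedNode r h n * h| < δ)
    (hx : IsDelaySolution q a r 0 x) (hxφ : ∀ t ∈ Icc (-q) 0, x t = φ t)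
    (hz : IsPCASolution q a r φ h z) (ht : 0 ≤ t) (hη : 0 ≤ η)
    (hxη : ∀ u ∈ Icc (-q) t, ∀ v ∈ Icc (-q) t, |u - v| < δ → |x u - x v| ≤ η) :
    |x t - z (gridFloor h t)| ≤ η * Real.exp (M * t) := by
  have hq : 0 ≤ q := (hr 0).1.trans (hr 0).2
  obtain ⟨N, hN⟩ := Int.eq_ofNat_of_zero_le (Int.floor_nonneg.2 (div_nonneg ht hh.le))
  have hgrid : gridFloor h t = (N : ℤ) * h := by rw [gridFloor, hN]
  have hNt := gridFloor_le hh t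
  have hNt' := lt_gridFloor_add hh t
  have hN₀ := gridFloor_nonneg hh ht
  rw [hgrid] at hNt hNt' hN₀ ⊢
  have hini (j : ℤ) (hj : j ∈ Icc (0 - ⌊q / h⌋) 0) : x (j * h) = z (j * h) := by
    have hjh := intCast_mul_mem_Icc_sub hh hj
    rw [Int.cast_zero, zero_mul, zero_sub] at hjh
    rw [hxφ _ hjh, hz.initial j hjh.1 hjh.2]
  have hxω (n : ℤ) (hn : n ∈ Ico 0 (0 + (N : ℤ))) (u : ℝ) (hu : u ∈ Icc (n * h) ((n + 1) * h)) :
      |x (u - r u) - x (delayedNode r h n * h)| ≤ η := by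
    have hn₀ : (0 : ℝ) ≤ n * h := mul_nonneg (Int.cast_nonneg hn.1) hh.le
    have hnN : ((n + 1 : ℤ) : ℝ) * h ≤ (N : ℤ) * h :=
      mul_le_mul_of_nonneg_right (Int.cast_le.2 (by have := hn.2; omega)) hh.le
    have hnode_mem := intCast_mul_mem_Icc_sub hh (delayedNode_mem_Icc hh (hr (n * h)))
    rw [Int.cast_add, Int.cast_one] at hnN
    refine hxη _ ⟨?_, ?_⟩ _ ⟨?_, ?_⟩ (hnode n u hu) <;>
      linarith [hu.1, hu.2, (hr u).1, (hr u).2, hnode_mem.1, hnode_mem.2]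
  have hgridpt : |x ((N : ℤ) * h) - z ((N : ℤ) * h)| ≤ η * (Real.exp (M * h * N) - 1) :=
    abs_delaySolution_sub_differenceSolution_le hh ha hM hr (by simpa using hx)
      (hz.isDifferenceSolution hh ha hM) hini hη hxω N
      ⟨by have := Int.floor_nonneg.2 (div_nonneg hq hh.le); omega, by omega⟩
  have hlast : |x t - x ((N : ℤ) * h)| ≤ η :=
    hxη t ⟨by linarith, le_rfl⟩ _ ⟨by linarith, hNt⟩ (abs_sub_lt_iff.2 ⟨by linarith, by linarith⟩)
  calc |x t - z ((N : ℤ) * h)| ≤ η + η * (Real.exp (M * h * N) - 1) :=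
        (abs_sub_le _ _ _).trans (add_le_add hlast hgridpt)
    _ = η * Real.exp (M * ((N : ℤ) * h)) := by push_cast; ring_nf
    _ ≤ η * Real.exp (M * t) := by gcongr

theorem tendsto_delaySolution_sub_pcaSolution {z : ℝ → ℝ → ℝ} (hq : 0 < q)
    (ha : ∀ t, ContinuousWithinAt a (Ici t) t) (hM : ∀ t, |a t| ≤ M) (hr : ∀ t, r t ∈ Icc 0 q)
    (hruc : UniformContinuous r) (hx : IsDelaySolution q a r 0 x)
    (hxφ : ∀ t ∈ Icc (-q) 0, x t = φ t) (hz : ∀ h ∈ Ioc 0 q, IsPCASolution q a r φ h (z h))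
    (ht : 0 ≤ t) : Tendsto (fun h => |x t - z h (gridFloor h t)|) (𝓝[>] 0) (𝓝 0) := by
  have hxuc : UniformContinuousOn x (Icc (-q) t) :=
    isCompact_Icc.uniformContinuousOn_of_continuous <| hx.continuousOn.mono fun u hu => by
      rw [zero_sub]
      exact hu.1
  rw [Metric.tendsto_nhds]
  intro ε hε
  obtain ⟨η, hη, hηε⟩ := exists_pos_mul_lt hε (Real.exp (M * t))
  obtain ⟨δ, hδ, hxδ⟩ := Metric.uniformContinuousOn_iff.1 hxuc η hη
  filter_upwards [eventually_abs_delayedNode_sub_lt hruc hδ, Ioo_mem_nhdsGT (lt_min hδ hq)]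
    with h hnode ⟨hh, hlt⟩
  obtain ⟨hhδ, hhq⟩ := lt_min_iff.1 hlt
  rw [Real.dist_eq, sub_zero, abs_abs]
  refine lt_of_le_of_lt ?_ ((mul_comm _ _).trans_lt hηε)
  exact abs_delaySolution_sub_pcaSolution_le hh hhδ ha hM hr hnode hx hxφ (hz h ⟨hh, hhq.le⟩) ht
    hη.le fun u hu v hv huv => (hxδ u hu v hv huv).le

end Convergence

section Stability

variable {q h : ℝ} {a r : ℝ → ℝ} {M : ℝ≥0}

/-- A difference solution bounded by `1` on its initial window `[m - [q/h], m]` is bounded by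
`1 / 2` on the window `P` steps later, for every initial time `m ≥ 0`. -/
def HalvesWindow (q : ℝ) (a r : ℝ → ℝ) (h : ℝ) (P : ℕ) : Prop :=
  ∀ m : ℤ, 0 ≤ m → ∀ z, IsDifferenceSolution a r h m z →
    (∀ j ∈ Icc (m - ⌊q / h⌋) m, |z j| ≤ 1) →
    ∀ j ∈ Icc (m + P - ⌊q / h⌋) (m + P), |z j| ≤ 1 / 2

theorem IsDifferenceSolution.exists_isDelaySolution_abs_sub_le {m l : ℤ} {z : ℤ → ℝ} {B K : ℝ≥0}
    {η : ℝ} (hz : IsDifferenceSolution a r h m z) (hh : 0 < h)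
    (ha : ∀ t, ContinuousWithinAt a (Ici t) t) (hM : ∀ t, |a t| ≤ M) (hr : ∀ t, r t ∈ Icc 0 q)
    (hrc : Continuous r) (hml : m ≤ l - ⌊q / h⌋) (hB : ∀ j ∈ Icc (m - ⌊q / h⌋) l, |z j| ≤ B)
    (hBK : B ≤ K) (hK : ∀ x, IsDelaySolution q a r (l * h) x →
      (∀ t ∈ Icc (l * h - q) (l * h), |x t| ≤ B) → ∀ t, l * h - q ≤ t → |x t| ≤ K)
    (hη : 0 ≤ η)
    (hnode : ∀ n : ℤ, ∀ u ∈ Icc (n * h) ((n + 1) * h), |u - r u - delayedNode r h n * h| ≤ η)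
    (N : ℕ) :
    ∃ x, IsDelaySolution q a r (l * h) x ∧ (∀ t ∈ Icc (l * h - q) (l * h), |x t| ≤ B) ∧
      ∀ j ∈ Icc (l - ⌊q / h⌋) (l + N),
        |x (j * h) - z j| ≤ M * K * η * (Real.exp (M * h * N) - 1) := by
  have hL : 0 ≤ ⌊q / h⌋ := Int.floor_nonneg.2 (div_nonneg ((hr 0).1.trans (hr 0).2) hh.le)
  obtain ⟨ψ, hψ, hψB, hψz⟩ := hz.exists_lipschitzWith_interpolation hh hM hr hB
  obtain ⟨x, hx, hxψ⟩ := exists_isDelaySolution ha hM (fun t => (hr t).1) hrc q (l * h) ψ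
  have hxB (t : ℝ) (ht : t ∈ Icc (l * h - q) (l * h)) : |x t| ≤ B := by
    rw [hxψ ht.2]
    exact hψB t
  have hxLip : LipschitzWith (M * K) x := by
    refine lipschitzWith_of_Iic_of_Ici (s := l * h) (fun u hu v hv => ?_)
      (hx.lipschitzOnWith hM hr (hK x hx hxB))
    rw [hxψ hu, hxψ hv]
    exact hψ.weaken (mul_le_mul_right hBK M) u v
  have hini (j : ℤ) (hj : j ∈ Icc (l - ⌊q / h⌋) l) : x (j * h) = z j := by
    rw [hxψ (mul_le_mul_of_nonneg_right (Int.cast_le.2 hj.2) hh.le)]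
    exact hψz j ⟨hml.trans hj.1, hj.2⟩
  refine ⟨x, hx, hxB, abs_delaySolution_sub_differenceSolution_le hh ha hM hr hx
    (hz.mono (by omega)) hini (by positivity) fun n _ u hu => ?_⟩
  exact (hxLip.dist_le_mul _ _).trans
    (mul_le_mul_of_nonneg_left (hnode n u hu) (by positivity))

theorem exists_halvesWindow_of_abs_delayedNode_sub_le {g K : ℝ≥0} {T η : ℝ} (hh : 0 < h)
    (hhq : h ≤ q) (ha : ∀ t, ContinuousWithinAt a (Ici t) t) (hM : ∀ t, |a t| ≤ M)
    (hr : ∀ t, r t ∈ Icc 0 q) (hrc : Continuous r) (hg : Real.exp (M * q) ≤ g) (hgK : g ≤ K)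
    (hK : ∀ s, 0 ≤ s → ∀ x, IsDelaySolution q a r s x →
      (∀ t ∈ Icc (s - q) s, |x t| ≤ g) → ∀ t, s - q ≤ t → |x t| ≤ K)
    (hT : 0 < T) (hdecay : ∀ s, 0 ≤ s → ∀ x, IsDelaySolution q a r s x →
      (∀ t ∈ Icc (s - q) s, |x t| ≤ g) → ∀ t, s + T ≤ t → |x t| ≤ 1 / 4)
    (hη : 0 ≤ η) (hηle : M * K * Real.exp (M * (T + 2 * q)) * η ≤ 1 / 4)
    (hnode : ∀ n : ℤ, ∀ u ∈ Icc (n * h) ((n + 1) * h), |u - r u - delayedNode r h n * h| ≤ η) :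
    ∃ P > 0, HalvesWindow q a r h P := by
  have hq : 0 ≤ q := hh.le.trans hhq
  obtain ⟨L, hL⟩ := Int.eq_ofNat_of_zero_le (Int.floor_nonneg.2 (div_nonneg hq hh.le))
  have hLq : (L : ℝ) * h ≤ q := by
    simpa only [gridFloor, hL, Int.cast_natCast] using gridFloor_le hh q
  obtain ⟨R, hR₀, hTR, hRT⟩ : ∃ R : ℕ, 0 < R ∧ T ≤ R * h ∧ R * h ≤ T + h := by
    refine ⟨⌈T / h⌉₊, Nat.ceil_pos.2 (div_pos hT hh), (div_le_iff₀ hh).1 (Nat.le_ceil _), ?_⟩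
    rw [← le_div_iff₀ hh, add_div, div_self hh.ne']
    exact (Nat.ceil_lt_add_one (by positivity)).le
  refine ⟨L + R + L, by omega, fun m hm z hz hz₁ j hj => ?_⟩
  have hzg (j : ℤ) (hj : j ∈ Icc (m - ⌊q / h⌋) (m + L)) : |z j| ≤ g := by
    refine (hz.abs_le_mul_exp hh hM hr hz₁ L j hj).trans (le_trans ?_ hg)
    rw [one_mul, mul_assoc, mul_comm h]
    exact Real.exp_le_exp.2 (mul_le_mul_of_nonneg_left hLq M.2)
  have hs : (0 : ℝ) ≤ (m + L : ℤ) * h := mul_nonneg (Int.cast_nonneg (by omega)) hh.le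
  obtain ⟨x, hx, hxg, hxz⟩ := hz.exists_isDelaySolution_abs_sub_le hh ha hM hr hrc (by omega) hzg
    hgK (hK _ hs) hη hnode (R + L)
  push_cast at hj
  have hxj : |x (j * h)| ≤ 1 / 4 := by
    refine hdecay _ hs x hx hxg _ ?_
    have hRj : ((m + L + R : ℤ) : ℝ) * h ≤ j * h :=
      mul_le_mul_of_nonneg_right (Int.cast_le.2 (by have := hj.1; omega)) hh.le
    push_cast at hRj ⊢
    linarith
  have herr : |z j - x (j * h)| ≤ 1 / 4 := by
    rw [abs_sub_comm]
    calc |x (j * h) - z j| ≤ M * K * η * (Real.exp (M * h * (R + L : ℕ)) - 1) :=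
          hxz j ⟨by have := hj.1; omega, by have := hj.2; push_cast; omega⟩
      _ ≤ M * K * η * Real.exp (M * (T + 2 * q)) := by
          refine mul_le_mul_of_nonneg_left ((sub_le_self _ zero_le_one).trans ?_) (by positivity)
          rw [mul_assoc]
          gcongr
          push_cast
          linarith
      _ ≤ 1 / 4 := by linarith
  linarith [abs_sub_abs_le_abs_sub (z j) (x (j * h))]

theorem DelayUAS.eventually_exists_halvesWindow (hUAS : DelayUAS q a r) (hq : 0 < q)
    (ha : ∀ t, ContinuousWithinAt a (Ici t) t) (hM : ∀ t, |a t| ≤ M) (hr : ∀ t, r t ∈ Icc 0 q)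
    (hruc : UniformContinuous r) :
    ∀ᶠ h in 𝓝[>] 0, ∃ P > 0, HalvesWindow q a r h P := by
  let g : ℝ≥0 := ⟨Real.exp (M * q), (Real.exp_pos _).le⟩
  have hg : 0 < g := Real.exp_pos _
  obtain ⟨K, hgK, hK⟩ := hUAS.exists_uniform_bound hg
  obtain ⟨T, hT, hdecay⟩ := hUAS.exists_decay_time (C := g) hg (by norm_num : (0 : ℝ) < 1 / 4)
  obtain ⟨η, hη, hηle⟩ := exists_pos_mul_lt (by norm_num : (0 : ℝ) < 1 / 4)
    (M * K * Real.exp (M * (T + 2 * q)))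
  filter_upwards [eventually_abs_delayedNode_sub_lt hruc hη, Ioo_mem_nhdsGT hq]
    with h hnode ⟨hh, hhq⟩
  exact exists_halvesWindow_of_abs_delayedNode_sub_le hh hhq.le ha hM hr hruc.continuous le_rfl hgK
    hK hT hdecay hη.le hηle.le fun n u hu => (hnode n u hu).le

namespace HalvesWindow

variable {P : ℕ} {m : ℤ} {z : ℤ → ℝ} {A : ℝ}

theorem abs_le_half_mul (hP : HalvesWindow q a r h P) (hm : 0 ≤ m)
    (hz : IsDifferenceSolution a r h m z) (hA : 0 < A)
    (hzA : ∀ j ∈ Icc (m - ⌊q / h⌋) m, |z j| ≤ A) :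
    ∀ j ∈ Icc (m + P - ⌊q / h⌋) (m + P), |z j| ≤ A / 2 := by
  have habs (j : ℤ) : |A⁻¹ * z j| = |z j| / A := by
    rw [abs_mul, abs_of_pos (inv_pos.2 hA), inv_mul_eq_div]
  intro j hj
  have hhalf := hP m hm _ (hz.const_mul A⁻¹)
    (fun j hj => by rw [habs, div_le_one hA]; exact hzA j hj) j hj
  rw [habs, div_le_iff₀ hA] at hhalf
  linarith

theorem abs_le_mul_pow (hP : HalvesWindow q a r h P) (hm : 0 ≤ m)
    (hz : IsDifferenceSolution a r h m z) (hA : 0 < A)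
    (hzA : ∀ j ∈ Icc (m - ⌊q / h⌋) m, |z j| ≤ A) (k : ℕ) :
    ∀ j ∈ Icc (m + k * P - ⌊q / h⌋) (m + k * P), |z j| ≤ A * (1 / 2) ^ k := by
  induction k with
  | zero => simpa using hzA
  | succ k ih =>
    have hkP : (0 : ℤ) ≤ k * P := by positivity
    have hnext := hP.abs_le_half_mul (by omega) (hz.mono (by omega)) (by positivity) ih
    rwa [Nat.cast_succ, add_one_mul, ← add_assoc, pow_succ, ← mul_assoc, mul_one_div]

theorem abs_le_mul_pow_mul_exp (hP : HalvesWindow q a r h P) (hP₀ : 0 < P) (hh : 0 < h)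
    (hM : ∀ t, |a t| ≤ M) (hr : ∀ t, r t ∈ Icc 0 q) (hm : 0 ≤ m)
    (hz : IsDifferenceSolution a r h m z) (hA : 0 < A)
    (hzA : ∀ j ∈ Icc (m - ⌊q / h⌋) m, |z j| ≤ A) (k : ℕ) {n : ℤ} (hn : m + k * P ≤ n) :
    |z n| ≤ A * (1 / 2) ^ k * Real.exp (M * h * P) := by
  have hkP : (0 : ℤ) ≤ k * P := by positivity
  obtain ⟨t, rfl⟩ : ∃ t : ℕ, n = m + t := ⟨(n - m).toNat, by omega⟩
  have hki : k ≤ t / P := (Nat.le_div_iff_mul_le hP₀).2 (by zify; omega)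
  have hdiv : ((t / P : ℕ) * P : ℤ) + (t % P : ℕ) = t := by
    exact_mod_cast Nat.div_add_mod' t P
  have hmod := Nat.mod_lt t hP₀
  have hL : 0 ≤ ⌊q / h⌋ := Int.floor_nonneg.2 (div_nonneg ((hr 0).1.trans (hr 0).2) hh.le)
  have hiP : (0 : ℤ) ≤ (t / P : ℕ) * P := by positivity
  calc |z (m + t)| ≤ A * (1 / 2) ^ (t / P) * Real.exp (M * h * P) :=
        (hz.mono (by omega)).abs_le_mul_exp hh hM hr (hP.abs_le_mul_pow hm hz hA hzA (t / P)) P _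
          ⟨by omega, by omega⟩
    _ ≤ A * (1 / 2) ^ k * Real.exp (M * h * P) := by
        gcongr ?_ * ?_ * _
        exact pow_le_pow_of_le_one (by norm_num) (by norm_num) hki

theorem differenceUAS (hP : HalvesWindow q a r h P) (hP₀ : 0 < P) (hh : 0 < h)
    (hM : ∀ t, |a t| ≤ M) (hr : ∀ t, r t ∈ Icc 0 q) : DifferenceUAS q a r h := by
  set G := Real.exp (M * h * P)
  have hG₀ : 0 < G := Real.exp_pos _
  refine ⟨fun ε hε => ⟨ε / (2 * G), by positivity, fun m hm z hz hzδ n hn => ?_⟩,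
    1, one_pos, fun ε hε => ?_⟩
  · have hbound := hP.abs_le_mul_pow_mul_exp hP₀ hh hM hr hm hz (by positivity)
      (fun j hj => (hzδ j hj.1 hj.2).le) 0 (by simpa using hn)
    calc |z n| ≤ ε / (2 * G) * (1 / 2) ^ 0 * G := hbound
      _ = ε / 2 := by field_simp
      _ < ε := half_lt_self hε
  · obtain ⟨k, hk⟩ := exists_pow_lt_of_lt_one (div_pos hε hG₀) (one_half_lt_one (α := ℝ))
    refine ⟨k * P, fun m hm z hz hz₁ n hn => ?_⟩
    have hbound := hP.abs_le_mul_pow_mul_exp hP₀ hh hM hr hm hz one_pos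
      (fun j hj => (hz₁ j hj.1 hj.2).le) k (by exact_mod_cast hn)
    rw [one_mul] at hbound
    exact hbound.trans_lt ((lt_div_iff₀ hG₀).1 hk)

end HalvesWindow

end Stability

section HalfLine

theorem continuousWithinAt_Ici_comp_max {β : Type*} [TopologicalSpace β] {f : ℝ → β} {s : ℝ}
    (hf : ∀ t, s ≤ t → ContinuousWithinAt f (Ici t) t) (t : ℝ) :
    ContinuousWithinAt (fun u => f (max u s)) (Ici t) t :=
  (hf _ (le_max_right t s)).comp (f := fun u => max u s)
    (continuous_id.max continuous_const).continuousWithinAt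
    fun _ hu => max_le_max_right s (mem_Ici.1 hu)

theorem uniformContinuous_comp_max {β : Type*} [UniformSpace β] {f : ℝ → β} {s : ℝ}
    (hf : UniformContinuousOn f (Ici s)) : UniformContinuous fun u => f (max u s) := by
  rw [← uniformContinuousOn_univ]
  exact hf.comp (LipschitzWith.id.max_const s).uniformContinuous.uniformContinuousOn
    fun u _ => le_max_right u s

end HalfLine

theorem corollary4p2_general (q : ℝ) (hq : 0 < q) (a r : ℝ → ℝ)
    (ha_cont : ∀ t, 0 ≤ t → ContinuousWithinAt a (Ici t) t)
    (hr : ∀ t, 0 ≤ t → r t ∈ Icc 0 q) (ha_bdd : Bornology.IsBounded (a '' Ici 0))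
    (hruc : UniformContinuousOn r (Ici 0)) :
    (∀ φ x : ℝ → ℝ, IsDelaySolution q a r 0 x → (∀ t ∈ Icc (-q) 0, x t = φ t) →
      ∀ z : ℝ → ℝ → ℝ, (∀ h ∈ Ioc 0 q, IsPCASolution q a r φ h (z h)) →
      ∀ t, 0 ≤ t → Tendsto (fun h => |x t - z h (gridFloor h t)|) (𝓝[>] 0) (𝓝 0)) ∧
    (DelayUAS q a r → ∃ h₀ > 0, ∀ h, 0 < h → h < h₀ → DifferenceUAS q a r h) := by
  obtain ⟨M, hM₀, hM⟩ := ha_bdd.exists_pos_norm_le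
  lift M to ℝ≥0 using hM₀.le
  -- Extending `a` and `r` to the line by their values at `0` does not affect any solution.
  set a' : ℝ → ℝ := fun t => a (max t 0)
  set r' : ℝ → ℝ := fun t => r (max t 0)
  have haa' : EqOn a a' (Ici 0) := fun t ht => congrArg a (max_eq_left ht).symm
  have hrr' : EqOn r r' (Ici 0) := fun t ht => congrArg r (max_eq_left ht).symm
  have ha' : ∀ t, ContinuousWithinAt a' (Ici t) t := continuousWithinAt_Ici_comp_max ha_cont
  have hM' (t : ℝ) : |a' t| ≤ M := hM _ (mem_image_of_mem a (le_max_right t 0))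
  have hr' (t : ℝ) : r' t ∈ Icc 0 q := hr _ (le_max_right t 0)
  have hruc' : UniformContinuous r' := uniformContinuous_comp_max hruc
  refine ⟨fun φ x hx hxφ z hz t ht => ?_, fun hUAS => ?_⟩
  · exact tendsto_delaySolution_sub_pcaSolution hq ha' hM' hr' hruc' (hx.congr haa' hrr') hxφ
      (fun h hh => (hz h hh).congr hh.1 haa' hrr') ht
  · obtain ⟨h₀, hh₀, hhalf⟩ := mem_nhdsGT_iff_exists_Ioo_subset.1
      ((hUAS.congr haa' hrr').eventually_exists_halvesWindow hq ha' hM' hr' hruc')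
    refine ⟨h₀, hh₀, fun h hh hlt => ?_⟩
    obtain ⟨P, hP₀, hP⟩ := hhalf ⟨hh, hlt⟩
    exact (hP.differenceUAS hP₀ hh hM' hr').congr hh.le haa'.symm hrr'.symm

theorem corollary4p2 (q : ℝ) (hq : 0 < q) (a r : ℝ → ℝ)
    (ha : ∀ t, 0 ≤ t → 0 ≤ a t)
    (ha_cont : ∀ t, 0 ≤ t → ContinuousWithinAt a (Set.Ici t) t)
    (hr : ∀ t, 0 ≤ t → r t ∈ Set.Icc 0 q)
    (hA1 : DelayUAS q a r)
    (hA2 : BddAbove (a '' Set.Ici 0))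
    (hA3 : UniformContinuousOn r (Set.Ici 0)) :
    (∀ φ : ℝ → ℝ, ContinuousOn φ (Set.Icc (-q) 0) →
      ∀ x : ℝ → ℝ, IsDelaySolution q a r 0 x → (∀ t ∈ Set.Icc (-q) 0, x t = φ t) →
      ∀ z : ℝ → ℝ → ℝ, (∀ h ∈ Set.Ioc 0 q, IsPCASolution q a r φ h (z h)) →
      ∀ t, 0 ≤ t →
        Filter.Tendsto (fun h => |x t - z h (gridFloor h t)|)
          (nhdsWithin 0 (Set.Ioi 0)) (nhds 0)) ∧
    (∃ h₀ > 0, ∀ h, 0 < h → h < h₀ → DifferenceUAS q a r h) := by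
  have ha_bdd : Bornology.IsBounded (a '' Ici 0) := isBounded_iff_bddBelow_bddAbove.2
    ⟨⟨0, forall_mem_image.2 ha⟩, hA2⟩
  obtain ⟨hconv, hstab⟩ := corollary4p2_general q hq a r ha_cont hr ha_bdd hA3
  exact ⟨fun φ _ => hconv φ, hstab hA1⟩
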